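/- Let $\lambda_1,\lambda_2\in\mathbb R$ with $\lambda_1\lambda_2>0$, and let $u:\mathbb R\times\mathbb R^3\to\mathbb C$ be a (classical, global) solution of the cubic–quintic nonlinear Schrödinger equation $$iu_t+\Delta u=\lambda_1|u|^2u-\lambda_2|u|^4u .$$ Write $$M[u]=\int_{\mathbb R^3}|u(0,x)|^2dx,\qquad E_1[u]=\int_{\mathbb R^3}\Big(|\nabla u|^2+\tfrac{\lambda_1}{2}|u|^4-\tfrac{\lambda_2}{3}|u|^6\Big)(0,x)\,dx,$$ $$P[u]=\operatorname{Im}\int_{\mathbb R^3}\bar u\,\nabla u\,(0,x)\,dx,\qquad \widetilde P(0)=\operatorname{Im}\int_{\mathbb R^3}\langle x,\bar u\nabla u\rangle(0,x)\,dx .$$ We call $u$ a *breather* (with zero background) if there are $\omega>0$ and a function $Q_\omega\in C^\infty(\mathbb R^3)$ (possibly $Q_\omega=0$) with $-\Delta Q_\omega+\omega Q_\omega+\lambda_1|Q_\omega|^2Q_\omega-\lambda_2|Q_\omega|^4Q_\omega=0$ whose derivatives of order $j=0,1,2$ are bounded by $Ce^{-\gamma|x|}$ for some $C,\gamma>0$,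 such that $u(t,x)=e^{i\omega t}\big(Q_\omega(x)+z(t,x)\big)$, where $z\not\equiv0$ solves $$iz_t-\omega z+\Delta z=\lambda_1|Q_\omega+z|^2(Q_\omega+z)-\lambda_2|Q_\omega+z|^4(Q_\omega+z)-\lambda_1|Q_\omega|^2Q_\omega+\lambda_2|Q_\omega|^4Q_\omega$$ and (i) $u(t+2\pi/\omega,x)=u(t,x)$ for all $(t,x)$; (ii) $z(t,\cdot)\in C^\infty(\mathbb R^3)\cap H^1(\mathbb R^3)$ for all $t$; (iii) there are constants $C_j,\gamma_j>0$ ($j=0,1,2$) with $\sup_{t\in\mathbb R}|D_x^\gamma z(t,x)|\le C_je^{-\gamma_j|x|}$ for all $x$ and all multi-indices with $|\gamma|=j$. **Theorem.** Suppose $P[u]=0$. Then $u$ is not a breather in either of the following cases: 1. $\lambda_1<0$ and $E_1[u]>\dfrac{3\lambda_1^2}{128|\lambda_2|}\,\|u(0,\cdot)\|_{L^2}^2=\dfrac{3\lambda_1^2}{128|\lambda_2|}\,M[u]$; 2. $\lambda_1>0$, $E_1[u]<0$ and $\widetilde P(0)>0$. -/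

import Mathlib

open MeasureTheory

noncomputable section

namespace CQNLS

/-- Euclidean space `ℝⁿ`. -/
abbrev E (n : ℕ) : Type := EuclideanSpace ℝ (Fin n)

/-- The classical partial derivative `∂ⱼ f (x)`. -/
def pderiv {n : ℕ} (f : E n → ℂ) (j : Fin n) (x : E n) : ℂ :=
  fderiv ℝ f x (EuclideanSpace.single j (1 : ℝ))

/-- The cubic-quintic nonlinearity `λ₁ |w|² w - λ₂ |w|⁴ w`. -/
def nonlin (lam1 lam2 : ℝ) (w : ℂ) : ℂ :=
  (lam1 : ℂ) * ((‖w‖ ^ 2 : ℝ) : ℂ) * w - (lam2 : ℂ) * ((‖w‖ ^ 4 : ℝ) : ℂ) * w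

/-- `u` is a (global, classical) solution of
`i uₜ + Δu = λ₁ |u|² u - λ₂ |u|⁴ u` on `ℝ × ℝⁿ`. -/
def IsSolution {n : ℕ} (lam1 lam2 : ℝ) (u : ℝ → E n → ℂ) : Prop :=
  (∀ t, ContDiff ℝ 2 (u t)) ∧
    ∀ t x, DifferentiableAt ℝ (fun s => u s x) t ∧
      Complex.I * deriv (fun s => u s x) t + Laplacian.laplacian (u t) x
        = nonlin lam1 lam2 (u t x)

/-- The mass `∫ |f|²`. -/
def mass {n : ℕ} (f : E n → ℂ) : ℝ := ∫ x, ‖f x‖ ^ 2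

/-- The energy `∫ (|∇f|² + (λ₁/2) |f|⁴ - (λ₂/3) |f|⁶)`. -/
def energy {n : ℕ} (lam1 lam2 : ℝ) (f : E n → ℂ) : ℝ :=
  ∫ x, ((∑ j, ‖pderiv f j x‖ ^ 2) + lam1 / 2 * ‖f x‖ ^ 4 - lam2 / 3 * ‖f x‖ ^ 6)

/-- The momentum `Im ∫ (∇f) f̄`, a vector of `ℝⁿ`. -/
def momentum {n : ℕ} (f : E n → ℂ) (j : Fin n) : ℝ :=
  (∫ x, pderiv f j x * (starRingEnd ℂ) (f x)).im

/-- The virial (weighted momentum) `Im ∫ ⟨x, f̄ ∇f⟩`. -/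
def virial {n : ℕ} (f : E n → ℂ) : ℝ :=
  (∫ x : E n, ∑ j, (x j : ℂ) * ((starRingEnd ℂ) (f x) * pderiv f j x)).im

/-- Membership in `H¹(ℝⁿ)` of a function that is already of class `C¹`
(its weak gradient is then the classical one). -/
def MemH1 {n : ℕ} (f : E n → ℂ) : Prop :=
  MemLp f 2 ∧ MemLp (fun x => fderiv ℝ f x) 2

/-- A localized stationary profile of frequency `ω`: a smooth solution of
`-ΔQ + ωQ + λ₁ |Q|² Q - λ₂ |Q|⁴ Q = 0` that decays exponentially with its derivatives of order
at most two, so that `e^{iωt} Q(x)` is a localized standing wave. `Q = 0` is allowed: when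
`λ₁, λ₂ > 0` and `n = 3` there is no other one. -/
def IsProfile {n : ℕ} (lam1 lam2 ω : ℝ) (Q : E n → ℂ) : Prop :=
  ContDiff ℝ ((⊤ : ℕ∞) : WithTop ℕ∞) Q ∧
    (∀ x, -Laplacian.laplacian Q x + (ω : ℂ) * Q x + nonlin lam1 lam2 (Q x) = 0) ∧
    ∀ j : ℕ, j ≤ 2 → ∃ C γ : ℝ, 0 < C ∧ 0 < γ ∧
      ∀ x, ‖iteratedFDeriv ℝ j Q x‖ ≤ C * Real.exp (-γ * ‖x‖)

/-- `u` is a breather with zero background of the cubic-quintic NLS: for some `ω > 0` it is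
`e^{iωt} (Q + z)` with a localized stationary profile `Q` of frequency `ω` and a nontrivial
solution `z` of the equation perturbed around `Q`; `u` is periodic in time with period `2π/ω`;
each `z(t, ·)` is smooth and in `H¹`; and the spatial derivatives of `z` of order at most two
decay exponentially, uniformly in time. -/
def IsBreather {n : ℕ} (lam1 lam2 : ℝ) (u : ℝ → E n → ℂ) : Prop :=
  ∃ (ω : ℝ) (Q : E n → ℂ) (z : ℝ → E n → ℂ),
    0 < ω ∧ IsProfile lam1 lam2 ω Q ∧
    (∀ t x, u t x = Complex.exp (Complex.I * (ω * t : ℝ)) * (Q x + z t x)) ∧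
    z ≠ 0 ∧
    (∀ t x, DifferentiableAt ℝ (fun s => z s x) t ∧
      Complex.I * deriv (fun s => z s x) t - (ω : ℂ) * z t x + Laplacian.laplacian (z t) x
        = nonlin lam1 lam2 (Q x + z t x) - nonlin lam1 lam2 (Q x)) ∧
    (∀ t x, u (t + 2 * Real.pi / ω) x = u t x) ∧
    (∀ t, ContDiff ℝ ((⊤ : ℕ∞) : WithTop ℕ∞) (z t) ∧ MemH1 (z t)) ∧
    (∀ j : ℕ, j ≤ 2 → ∃ C γ : ℝ, 0 < C ∧ 0 < γ ∧
      ∀ t x, ‖iteratedFDeriv ℝ j (z t) x‖ ≤ C * Real.exp (-γ * ‖x‖))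

end CQNLS

end

open Filter Topology
open scoped InnerProductSpace

noncomputable section

namespace CQNLS

variable {n : ℕ} {lam1 lam2 : ℝ}

/-! The engine is the virial identity. With `K = ∫|∇u|²`, `A = ∫|u|⁴`, `B = ∫|u|⁶`, in dimension
three the virial has time derivative `V' = 2K + (3λ₁/2)A - 2λ₂B`. A breather is periodic in time, so
`V' = 0` at some time by Rolle's theorem. Mass and energy are conserved, so at that time `E = K +
(λ₁/2)A - (λ₂/3)B` is still the initial energy. Eliminating `K` gives `2E = -(λ₁/2)A + (4λ₂/3)B`,
which for negative coefficients is bounded by a multiple of the mass after completing a square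
(`quartic_sextic_lower_bound`). Eliminating `B` instead gives `E = (2/3)K + (λ₁/4)A`, which is
nonnegative for `λ₁ > 0`. Either conclusion contradicts the corresponding energy hypothesis.

The labour lies in differentiating in time (`hasDerivAt_gradient`, `hasDerivAt_virial_form`). The
solution is only pointwise differentiable in `t`, and only its spatial derivatives of order at most
two are controlled uniformly in `t`; no mixed derivative `∂ₜ∇u` is at hand. All computations
therefore use difference quotients in time, with integration by parts to take the space derivatives
off them. Gradients converge by interpolation (`tendsto_pderiv`), the Laplacian only weakly. One
fixed integrable weight replaces the various exponential rates and dominates all the integrals. -/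

/-- The polynomial weight `(1 + |x|)^{-(n+2)}`, integrable on `ℝⁿ`. -/
def weight (x : E n) : ℝ := ((1 + ‖x‖) ^ (n + 2))⁻¹

lemma weight_pos (x : E n) : 0 < weight x := by unfold weight; positivity

lemma weight_le_one (x : E n) : weight x ≤ 1 := by
  unfold weight
  exact inv_le_one_of_one_le₀ (one_le_pow₀ (by linarith [norm_nonneg x]))

lemma norm_mul_weight_le_one (x : E n) : ‖x‖ * weight x ≤ 1 := by
  unfold weight
  rw [← div_eq_mul_inv, div_le_one (by positivity)]
  have h : 1 ≤ 1 + ‖x‖ := by linarith [norm_nonneg x]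
  calc ‖x‖ ≤ (1 + ‖x‖) ^ 1 := by linarith [pow_one (1 + ‖x‖)]
    _ ≤ _ := pow_le_pow_right₀ h (by omega)

lemma integrable_weight : Integrable (weight : E n → ℝ) := by
  have h := integrable_one_add_norm (E := E n) (μ := volume) (r := (n + 2 : ℕ))
    (by rw [finrank_euclideanSpace_fin]; push_cast; linarith)
  refine h.congr (Eventually.of_forall fun x => ?_)
  simp only [weight]
  rw [Real.rpow_neg (by positivity), Real.rpow_natCast]

/-- Exponential decay is faster than the weight. -/
lemma exp_le_weight {γ : ℝ} (hγ : 0 < γ) :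
    ∃ C, 0 ≤ C ∧ ∀ x : E n, Real.exp (-γ * ‖x‖) ≤ C * weight x := by
  -- The constant comes from `s^m / m! ≤ e^s` with `s = γ(1 + ‖x‖)` and `m = n + 2`.
  refine ⟨(n + 2).factorial * Real.exp γ / γ ^ (n + 2), by positivity, fun x => ?_⟩
  have h := Real.pow_div_factorial_le_exp (γ * (1 + ‖x‖)) (by positivity) (n + 2)
  rw [div_le_iff₀ (by positivity), mul_pow, mul_add, Real.exp_add, mul_one] at h
  unfold weight
  rw [neg_mul, Real.exp_neg, ← div_eq_mul_inv, div_div, inv_eq_one_div,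
    div_le_div_iff₀ (by positivity) (by positivity)]
  linarith

/-! ### Stability properties of decaying functions -/

/-- Continuous functions dominated by the weight. -/
def Decays {F : Type*} [NormedAddCommGroup F] (f : E n → F) : Prop :=
  Continuous f ∧ ∃ C, 0 ≤ C ∧ ∀ x, ‖f x‖ ≤ C * weight x

lemma abs_coord_le_norm (x : E n) (j : Fin n) : |x j| ≤ ‖x‖ := by
  simpa using EuclideanSpace.norm_eq x ▸ PiLp.norm_apply_le x j

lemma abs_coord_mul_weight_le_one (x : E n) (j : Fin n) : |x j| * weight x ≤ 1 :=
  (mul_le_mul_of_nonneg_right (abs_coord_le_norm x j) (weight_pos x).le).trans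
    (norm_mul_weight_le_one x)

namespace Decays

section

variable {F : Type*} [NormedAddCommGroup F] {f g : E n → F}

lemma integrable (hf : Decays f) : Integrable f := by
  obtain ⟨hc, C, -, hC⟩ := hf
  exact (integrable_weight.const_mul C).mono' hc.aestronglyMeasurable (Eventually.of_forall hC)

lemma of_norm_le (hg : Decays g) {G : Type*} [NormedAddCommGroup G] {h : E n → G}
    (hc : Continuous h) {K : ℝ} (hK : 0 ≤ K) (hle : ∀ x, ‖h x‖ ≤ K * ‖g x‖) : Decays h := by
  obtain ⟨-, C, hC0, hC⟩ := hg
  refine ⟨hc, K * C, by positivity, fun x => (hle x).trans ?_⟩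
  rw [mul_assoc]
  exact mul_le_mul_of_nonneg_left (hC x) hK

lemma add (hf : Decays f) (hg : Decays g) : Decays fun x => f x + g x := by
  obtain ⟨hcf, C, hC0, hC⟩ := hf
  obtain ⟨hcg, D, hD0, hD⟩ := hg
  refine ⟨hcf.add hcg, C + D, by positivity, fun x => (norm_add_le _ _).trans ?_⟩
  rw [add_mul]
  exact add_le_add (hC x) (hD x)

lemma neg (hf : Decays f) : Decays fun x => -f x :=
  hf.of_norm_le hf.1.neg zero_le_one fun x => by simp

lemma sub (hf : Decays f) (hg : Decays g) : Decays fun x => f x - g x := by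
  simpa [sub_eq_add_neg] using hf.add hg.neg

lemma sum {ι : Type*} (s : Finset ι) {f : ι → E n → F} (hf : ∀ i ∈ s, Decays (f i)) :
    Decays fun x => ∑ i ∈ s, f i x := by
  classical
  induction s using Finset.induction_on with
  | empty => exact ⟨by simpa using continuous_const, 0, le_rfl, by simp⟩
  | insert a s ha ih =>
    simp only [Finset.sum_insert ha]
    exact (hf a (by simp)).add (ih fun i hi => hf i (by simp [hi]))

lemma bounded (hf : Decays f) : ∃ C, 0 ≤ C ∧ ∀ x, ‖f x‖ ≤ C := by
  obtain ⟨-, C, hC0, hC⟩ := hf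
  exact ⟨C, hC0, fun x => (hC x).trans (mul_le_of_le_one_right hC0 (weight_le_one x))⟩

lemma const_smul [NormedSpace ℝ F] (hf : Decays f) (c : ℝ) : Decays fun x => c • f x :=
  hf.of_norm_le (hf.1.const_smul c) (norm_nonneg c) fun _ => (norm_smul _ _).le

end

section

variable {f g : E n → ℂ}

lemma inner (hf : Decays f) (hg : Decays g) : Decays fun x => ⟪f x, g x⟫_ℝ := by
  obtain ⟨C, hC0, hC⟩ := hf.bounded
  exact hg.of_norm_le (hf.1.inner hg.1) hC0 fun x => (norm_inner_le_norm _ _).trans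
    (mul_le_mul_of_nonneg_right (hC x) (norm_nonneg _))

/-- The weight bounding `f` absorbs the factor `x j`, and the decay of `g` remains. This is why
virial integrands are integrable without tracking moments. -/
lemma coord_inner (hf : Decays f) (hg : Decays g) (j : Fin n) :
    Decays fun x => x j * ⟪f x, g x⟫_ℝ := by
  obtain ⟨-, C, hC0, hC⟩ := id hf
  refine hg.of_norm_le ((by fun_prop : Continuous fun x : E n => x j).mul (hf.1.inner hg.1))
    hC0 fun x => ?_
  rw [norm_mul, Real.norm_eq_abs]
  calc |x j| * ‖⟪f x, g x⟫_ℝ‖ ≤ |x j| * ((C * weight x) * ‖g x‖) := by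
        gcongr
        exact (norm_inner_le_norm _ _).trans (mul_le_mul_of_nonneg_right (hC x) (norm_nonneg _))
    _ = (|x j| * weight x) * (C * ‖g x‖) := by ring
    _ ≤ 1 * (C * ‖g x‖) := by
        gcongr
        exact abs_coord_mul_weight_le_one x j
    _ = _ := one_mul _

lemma I_mul (hf : Decays f) : Decays fun x => Complex.I * f x :=
  hf.of_norm_le (continuous_const.mul hf.1) zero_le_one (by simp)

lemma norm_sq (hf : Decays f) : Decays fun x => ‖f x‖ ^ 2 := by
  simpa using hf.inner hf

lemma norm_pow (hf : Decays f) (k : ℕ) : Decays fun x => ‖f x‖ ^ (k + 1) := by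
  obtain ⟨C, hC0, hC⟩ := hf.bounded
  refine hf.of_norm_le (hf.1.norm.pow _) (pow_nonneg hC0 k) fun x => ?_
  rw [_root_.norm_pow, norm_norm, pow_succ]
  gcongr
  exact hC x

end

end Decays

lemma inner_I_mul_left (a b : ℂ) : ⟪Complex.I * a, b⟫_ℝ = -⟪a, Complex.I * b⟫_ℝ := by
  simp [Complex.inner]; ring

/-- Orthogonality of `a` and `i a` over the reals is the cancellation behind both conservation laws.
-/
lemma inner_I_mul_self (a : ℂ) : ⟪Complex.I * a, a⟫_ℝ = 0 := by
  simp [Complex.inner]; ring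

/-! ### Integration by parts for decaying `C²` functions -/

/-- Functions of class `C²` whose partial derivatives of order at most two decay. -/
structure DecaysC2 (f : E n → ℂ) : Prop where
  contDiff : ContDiff ℝ 2 f
  decays : Decays f
  decays_pderiv : ∀ j, Decays (pderiv f j)
  decays_pderiv₂ : ∀ j k, Decays (pderiv (pderiv f j) k)

lemma pderiv_contDiff {f : E n → ℂ} (hf : ContDiff ℝ 2 f) (j : Fin n) :
    ContDiff ℝ 1 (pderiv f j) :=
  (hf.fderiv_right (m := 1) (by norm_num)).clm_apply contDiff_const

lemma pderiv_pderiv {f : E n → ℂ} (hf : ContDiff ℝ 2 f) (j k : Fin n) (x : E n) :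
    pderiv (pderiv f j) k x = iteratedFDeriv ℝ 2 f x
      ![EuclideanSpace.single k (1 : ℝ), EuclideanSpace.single j (1 : ℝ)] := by
  have h : DifferentiableAt ℝ (fderiv ℝ f) x :=
    (hf.fderiv_right (m := 1) (by norm_num)).differentiable (by norm_num) x
  rw [iteratedFDeriv_two_apply]
  unfold pderiv
  rw [fderiv_clm_apply h (by fun_prop)]
  simp

lemma pderiv_comm {f : E n → ℂ} (hf : ContDiff ℝ 2 f) (j k : Fin n) (x : E n) :
    pderiv (pderiv f j) k x = pderiv (pderiv f k) j x := by
  rw [pderiv_pderiv hf, pderiv_pderiv hf, iteratedFDeriv_two_apply, iteratedFDeriv_two_apply]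
  exact hf.contDiffAt.isSymmSndFDerivAt (by simp) _ _

lemma laplacian_eq_sum_pderiv {f : E n → ℂ} (hf : ContDiff ℝ 2 f) (x : E n) :
    Laplacian.laplacian f x = ∑ j, pderiv (pderiv f j) j x := by
  rw [InnerProductSpace.laplacian_eq_iteratedFDeriv_orthonormalBasis f
    (EuclideanSpace.basisFun (Fin n) ℝ)]
  simp [pderiv_pderiv hf]

lemma integral_inner_pderiv {f g : E n → ℂ} (j : Fin n) (hf : Differentiable ℝ f)
    (hg : Differentiable ℝ g) (h1 : Integrable fun x => ⟪pderiv f j x, g x⟫_ℝ)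
    (h2 : Integrable fun x => ⟪f x, pderiv g j x⟫_ℝ) (h3 : Integrable fun x => ⟪f x, g x⟫_ℝ) :
    ∫ x, ⟪f x, pderiv g j x⟫_ℝ = -∫ x, ⟪pderiv f j x, g x⟫_ℝ :=
  integral_bilinear_fderiv_right_eq_neg_left_of_integrable
    (B := (innerSL ℝ : ℂ →L[ℝ] ℂ →L[ℝ] ℝ)) (v := EuclideanSpace.single j (1 : ℝ)) h1 h2 h3
    (fun x _ => hf x) (fun x _ => hg x)

/-- Integration by parts against a coordinate function. -/
lemma integral_coord_mul_fderiv {h : E n → ℝ} (j : Fin n) (hh : Differentiable ℝ h)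
    (h1 : Integrable h)
    (h2 : Integrable fun x => x j * fderiv ℝ h x (EuclideanSpace.single j (1 : ℝ)))
    (h3 : Integrable fun x => x j * h x) :
    ∫ x, x j * fderiv ℝ h x (EuclideanSpace.single j (1 : ℝ)) = -∫ x, h x := by
  have hx : ∀ x : E n, HasFDerivAt (fun x : E n => x j) (EuclideanSpace.proj j : E n →L[ℝ] ℝ) x :=
    fun x => (EuclideanSpace.proj j : E n →L[ℝ] ℝ).hasFDerivAt
  have key : ∀ x : E n,
      fderiv ℝ (fun x : E n => x j) x (EuclideanSpace.single j (1 : ℝ)) = 1 := fun x => by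
    rw [(hx x).fderiv]; simp
  rw [integral_mul_fderiv_eq_neg_fderiv_mul_of_integrable _ h2 h3
    (fun x _ => (hx x).differentiableAt) (fun x _ => hh x)]
  · simp only [key, one_mul]
  · simpa only [key, one_mul] using h1

namespace DecaysC2

variable {f g : E n → ℂ}

lemma differentiable (hf : DecaysC2 f) : Differentiable ℝ f :=
  hf.contDiff.differentiable (by norm_num)

lemma differentiable_pderiv (hf : DecaysC2 f) (j : Fin n) : Differentiable ℝ (pderiv f j) :=
  (pderiv_contDiff hf.contDiff j).differentiable (by norm_num)

lemma decays_laplacian (hf : DecaysC2 f) : Decays (Laplacian.laplacian f) := by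
  rw [funext (laplacian_eq_sum_pderiv hf.contDiff)]
  exact Decays.sum _ fun j _ => hf.decays_pderiv₂ j j

lemma integral_inner_pderiv (hf : DecaysC2 f) (hg : DecaysC2 g) (j : Fin n) :
    ∫ x, ⟪f x, pderiv g j x⟫_ℝ = -∫ x, ⟪pderiv f j x, g x⟫_ℝ :=
  CQNLS.integral_inner_pderiv j hf.differentiable hg.differentiable
    ((hf.decays_pderiv j).inner hg.decays).integrable
    (hf.decays.inner (hg.decays_pderiv j)).integrable (hf.decays.inner hg.decays).integrable

/-- Green's identity. -/
lemma integral_inner_laplacian (hf : DecaysC2 f) (hg : DecaysC2 g) :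
    ∫ x, ⟪Laplacian.laplacian f x, g x⟫_ℝ = -∫ x, ∑ j, ⟪pderiv f j x, pderiv g j x⟫_ℝ := by
  simp only [laplacian_eq_sum_pderiv hf.contDiff, sum_inner]
  rw [integral_finsetSum _ fun j _ => ((hf.decays_pderiv₂ j j).inner hg.decays).integrable,
    integral_finsetSum _ fun j _ => ((hf.decays_pderiv j).inner (hg.decays_pderiv j)).integrable,
    ← Finset.sum_neg_distrib]
  refine Finset.sum_congr rfl fun j _ => ?_
  rw [CQNLS.integral_inner_pderiv j (hf.differentiable_pderiv j) hg.differentiable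
    ((hf.decays_pderiv₂ j j).inner hg.decays).integrable
    ((hf.decays_pderiv j).inner (hg.decays_pderiv j)).integrable
    ((hf.decays_pderiv j).inner hg.decays).integrable, neg_neg]

/-- The Pohozaev identity for the Laplacian. -/
lemma integral_coord_inner_laplacian (hf : DecaysC2 f) :
    ∫ x, ∑ j, x j * ⟪Laplacian.laplacian f x, pderiv f j x⟫_ℝ
      = ((n : ℝ) / 2 - 1) * ∫ x, ∑ j, ‖pderiv f j x‖ ^ 2 := by
  have hx : ∀ (j : Fin n) (x : E n),
      HasFDerivAt (fun x : E n => x j) (EuclideanSpace.proj j : E n →L[ℝ] ℝ) x :=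
    fun j x => (EuclideanSpace.proj j : E n →L[ℝ] ℝ).hasFDerivAt
  -- Two integrations by parts. Moving one `∂ₖ` onto `xⱼ ∂ⱼf` yields the diagonal term and, after
  -- commuting derivatives, `-½ ∫ xⱼ ∂ⱼ|∂ₖf|²`; the second, against `xⱼ`, turns this into `½ ∫
  -- |∂ₖf|²`. Summation over `j, k` produces the factor `n/2 - 1`.
  have main : ∀ j k, ∫ x, x j * ⟪pderiv (pderiv f k) k x, pderiv f j x⟫_ℝ
      = (if j = k then -∫ x, ‖pderiv f k x‖ ^ 2 else 0) + 1 / 2 * ∫ x, ‖pderiv f k x‖ ^ 2 := by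
    intro j k
    have hder : ∀ x, pderiv (fun x => (x j : ℝ) • pderiv f j x) k x
        = x j • pderiv (pderiv f k) j x + (if j = k then pderiv f k x else 0) := by
      intro x
      have h1 : HasFDerivAt (fun x : E n => (x j : ℝ) • pderiv f j x) _ x :=
        (hx j x).smul (hf.differentiable_pderiv j x).hasFDerivAt
      rw [← pderiv_comm hf.contDiff j k x, pderiv, h1.fderiv]
      by_cases hjk : j = k <;> simp [hjk, pderiv]
    have i1 : Integrable fun x => x j * ⟪pderiv f k x, pderiv (pderiv f k) j x⟫_ℝ :=
      ((hf.decays_pderiv k).coord_inner (hf.decays_pderiv₂ k j) j).integrable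
    have i2 : Integrable fun x => ‖pderiv f k x‖ ^ 2 := (hf.decays_pderiv k).norm_sq.integrable
    have i3 : Integrable fun x => if j = k then ‖pderiv f k x‖ ^ 2 else (0 : ℝ) := by
      split_ifs <;> simp [i2]
    have e : ∀ x, ⟪pderiv f k x, pderiv (fun x => (x j : ℝ) • pderiv f j x) k x⟫_ℝ
        = x j * ⟪pderiv f k x, pderiv (pderiv f k) j x⟫_ℝ
          + (if j = k then ‖pderiv f k x‖ ^ 2 else 0) := by
      intro x
      rw [hder, inner_add_right, real_inner_smul_right]
      split_ifs <;> simp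
    have step := CQNLS.integral_inner_pderiv (f := pderiv f k)
      (g := fun x => (x j : ℝ) • pderiv f j x) k
      (hf.differentiable_pderiv k)
      (fun x => ((hx j x).smul (hf.differentiable_pderiv j x).hasFDerivAt).differentiableAt)
      (by simpa only [real_inner_smul_right] using
        ((hf.decays_pderiv₂ k k).coord_inner (hf.decays_pderiv j) j).integrable)
      (by simp only [e]; exact i1.add i3)
      (by simpa only [real_inner_smul_right] using
        ((hf.decays_pderiv k).coord_inner (hf.decays_pderiv j) j).integrable)
    simp only [e, real_inner_smul_right] at step
    rw [integral_add i1 i3] at step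
    have hsq : ∀ x, fderiv ℝ (fun x => ‖pderiv f k x‖ ^ 2) x (EuclideanSpace.single j (1 : ℝ))
        = 2 * ⟪pderiv f k x, pderiv (pderiv f k) j x⟫_ℝ := by
      intro x
      rw [(hf.differentiable_pderiv k x).hasFDerivAt.norm_sq.fderiv, two_nsmul, two_mul]
      rfl
    have step2 := integral_coord_mul_fderiv (h := fun x => ‖pderiv f k x‖ ^ 2) j
      (fun x => (hf.differentiable_pderiv k x).hasFDerivAt.norm_sq.differentiableAt) i2
      (by simpa only [hsq, mul_left_comm _ (2 : ℝ)] using i1.const_mul 2)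
      (by simpa only [real_inner_self_eq_norm_sq] using
        ((hf.decays_pderiv k).coord_inner (hf.decays_pderiv k) j).integrable)
    simp only [hsq, mul_left_comm _ (2 : ℝ)] at step2
    rw [integral_const_mul] at step2
    by_cases hjk : j = k
    · simp only [hjk, if_true] at step step2 ⊢
      linarith
    · simp only [hjk, if_false, integral_zero] at step ⊢
      linarith
  simp only [laplacian_eq_sum_pderiv hf.contDiff, sum_inner, Finset.mul_sum]
  have i : ∀ j k, Integrable fun x : E n => x j * ⟪pderiv (pderiv f k) k x, pderiv f j x⟫_ℝ :=
    fun j k => ((hf.decays_pderiv₂ k k).coord_inner (hf.decays_pderiv j) j).integrable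
  rw [integral_finsetSum _ fun j _ => integrable_finsetSum _ fun k _ => i j k,
    integral_finsetSum _ fun k _ => (hf.decays_pderiv k).norm_sq.integrable]
  simp_rw [fun j => integral_finsetSum (μ := (volume : Measure (E n))) Finset.univ
    fun k (_ : k ∈ Finset.univ) => i j k, main]
  rw [Finset.sum_congr rfl fun j _ => Finset.sum_add_distrib, Finset.sum_add_distrib]
  simp only [Finset.sum_ite_eq, Finset.mem_univ, if_true, Finset.sum_const, Finset.card_univ,
    Fintype.card_fin, nsmul_eq_mul, Finset.sum_neg_distrib, ← Finset.mul_sum]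
  ring

end DecaysC2

/-! ### The nonlinearity and its potential -/

lemma nonlin_eq_smul (lam1 lam2 : ℝ) (w : ℂ) :
    nonlin lam1 lam2 w = (lam1 * ‖w‖ ^ 2 - lam2 * ‖w‖ ^ 4) • w := by
  unfold nonlin
  rw [Complex.real_smul]
  push_cast
  ring

lemma inner_nonlin_self (lam1 lam2 : ℝ) (w : ℂ) :
    ⟪nonlin lam1 lam2 w, w⟫_ℝ = lam1 * ‖w‖ ^ 4 - lam2 * ‖w‖ ^ 6 := by
  rw [nonlin_eq_smul, real_inner_smul_left, real_inner_self_eq_norm_sq]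
  ring

lemma continuous_nonlin (lam1 lam2 : ℝ) : Continuous (nonlin lam1 lam2) := by
  rw [funext (nonlin_eq_smul lam1 lam2)]
  fun_prop

lemma norm_nonlin_le {K : ℝ} {w : ℂ} (hw : ‖w‖ ≤ K) :
    ‖nonlin lam1 lam2 w‖ ≤ (|lam1| * K ^ 2 + |lam2| * K ^ 4) * ‖w‖ := by
  rw [nonlin_eq_smul, norm_smul, Real.norm_eq_abs]
  gcongr
  refine (abs_sub _ _).trans ?_
  rw [abs_mul, abs_mul, abs_of_nonneg (by positivity : 0 ≤ ‖w‖ ^ 2),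
    abs_of_nonneg (by positivity : 0 ≤ ‖w‖ ^ 4)]
  gcongr

/-- The potential whose real gradient is the nonlinearity. -/
def potential (lam1 lam2 : ℝ) (w : ℂ) : ℝ := lam1 / 4 * ‖w‖ ^ 4 - lam2 / 6 * ‖w‖ ^ 6

lemma hasFDerivAt_potential (lam1 lam2 : ℝ) (w : ℂ) :
    HasFDerivAt (potential lam1 lam2) (innerSL ℝ (nonlin lam1 lam2 w) : ℂ →L[ℝ] ℝ) w := by
  have h := (hasFDerivAt_id (𝕜 := ℝ) w).norm_sq
  have h' := ((h.pow 2).const_mul (lam1 / 4)).sub ((h.pow 3).const_mul (lam2 / 6))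
  have e : potential lam1 lam2 = fun w : ℂ =>
      lam1 / 4 * (‖id w‖ ^ 2) ^ 2 - lam2 / 6 * (‖id w‖ ^ 2) ^ 3 := by
    funext w
    simp only [potential, id]
    ring
  rw [e]
  refine h'.congr_fderiv (ContinuousLinearMap.ext fun v => ?_)
  have hv : (innerSL ℝ (nonlin lam1 lam2 w) : ℂ →L[ℝ] ℝ) v
      = (lam1 * ‖w‖ ^ 2 - lam2 * ‖w‖ ^ 4) * ⟪w, v⟫_ℝ := by
    rw [innerSL_apply_apply, nonlin_eq_smul, real_inner_smul_left]
  rw [hv]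
  simp [-Complex.inner]
  ring

namespace Decays

variable {f : E n → ℂ}

lemma nonlin (hf : Decays f) (lam1 lam2 : ℝ) : Decays fun x => nonlin lam1 lam2 (f x) := by
  obtain ⟨K, hK0, hK⟩ := hf.bounded
  exact hf.of_norm_le ((continuous_nonlin _ _).comp hf.1) (by positivity)
    fun x => norm_nonlin_le (hK x)

lemma potential (hf : Decays f) (lam1 lam2 : ℝ) : Decays fun x => potential lam1 lam2 (f x) :=
  ((hf.norm_pow 3).const_smul (lam1 / 4)).sub ((hf.norm_pow 5).const_smul (lam2 / 6))

lemma coord_potential (hf : Decays f) (lam1 lam2 : ℝ) (j : Fin n) :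
    Decays fun x => x j * CQNLS.potential lam1 lam2 (f x) := by
  -- With coefficients `λ₁/4` and `λ₂/6`, the pairing of the nonlinearity with its argument is
  -- exactly the potential.
  have h := ((hf.nonlin (lam1 / 4) (lam2 / 6)).coord_inner hf j)
  simpa only [inner_nonlin_self, CQNLS.potential] using h

end Decays

namespace DecaysC2

variable {f g : E n → ℂ}

/-- The virial contribution of the nonlinearity. -/
lemma integral_coord_inner_nonlin (hf : DecaysC2 f) (lam1 lam2 : ℝ) :
    ∫ x, ∑ j, x j * ⟪nonlin lam1 lam2 (f x), pderiv f j x⟫_ℝ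
      = -(n : ℝ) * ∫ x, potential lam1 lam2 (f x) := by
  have hd : ∀ x, HasFDerivAt (fun x => potential lam1 lam2 (f x))
      ((innerSL ℝ (nonlin lam1 lam2 (f x)) : ℂ →L[ℝ] ℝ) ∘L fderiv ℝ f x) x := fun x =>
    (hasFDerivAt_potential lam1 lam2 (f x)).comp x (hf.differentiable x).hasFDerivAt
  have e : ∀ j x, fderiv ℝ (fun x => potential lam1 lam2 (f x)) x
      (EuclideanSpace.single j (1 : ℝ)) = ⟪nonlin lam1 lam2 (f x), pderiv f j x⟫_ℝ := by
    intro j x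
    rw [(hd x).fderiv]
    rfl
  have i : ∀ j, Integrable fun x => x j * ⟪nonlin lam1 lam2 (f x), pderiv f j x⟫_ℝ := fun j =>
    ((hf.decays.nonlin lam1 lam2).coord_inner (hf.decays_pderiv j) j).integrable
  rw [integral_finsetSum _ fun j _ => i j]
  have : ∀ j : Fin n, ∫ x, x j * ⟪nonlin lam1 lam2 (f x), pderiv f j x⟫_ℝ
      = -∫ x, potential lam1 lam2 (f x) := by
    intro j
    simp only [← e]
    exact integral_coord_mul_fderiv j (fun x => (hd x).differentiableAt)
      (hf.decays.potential _ _).integrable (by simpa only [e] using i j)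
      (hf.decays.coord_potential _ _ j).integrable
  simp only [this, Finset.sum_const, Finset.card_univ, Fintype.card_fin, nsmul_eq_mul]
  ring

lemma sub (hf : DecaysC2 f) (hg : DecaysC2 g) : DecaysC2 fun x => f x - g x := by
  have e : ∀ j, pderiv (fun x => f x - g x) j = fun x => pderiv f j x - pderiv g j x := by
    intro j
    funext x
    simp only [pderiv]
    rw [fderiv_fun_sub (hf.differentiable x) (hg.differentiable x)]
    rfl
  refine ⟨hf.contDiff.sub hg.contDiff, hf.decays.sub hg.decays, fun j => ?_, fun j k => ?_⟩
  · rw [e]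
    exact (hf.decays_pderiv j).sub (hg.decays_pderiv j)
  · have : pderiv (pderiv (fun x => f x - g x) j) k
        = fun x => pderiv (pderiv f j) k x - pderiv (pderiv g j) k x := by
      rw [e]
      funext x
      rw [pderiv, fderiv_fun_sub (hf.differentiable_pderiv j x) (hg.differentiable_pderiv j x)]
      rfl
    rw [this]
    exact (hf.decays_pderiv₂ j k).sub (hg.decays_pderiv₂ j k)

lemma const_smul (hf : DecaysC2 f) (c : ℝ) : DecaysC2 fun x => c • f x := by
  have e : ∀ j, pderiv (fun x => c • f x) j = fun x => c • pderiv f j x := by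
    intro j
    funext x
    rw [pderiv, fderiv_fun_const_smul (hf.differentiable x)]
    rfl
  refine ⟨hf.contDiff.const_smul c, hf.decays.const_smul c, fun j => ?_, fun j k => ?_⟩
  · rw [e]
    exact (hf.decays_pderiv j).const_smul c
  · have : pderiv (pderiv (fun x => c • f x) j) k = fun x => c • pderiv (pderiv f j) k x := by
      rw [e]
      funext x
      rw [pderiv, fderiv_fun_const_smul (hf.differentiable_pderiv j x)]
      rfl
    rw [this]
    exact (hf.decays_pderiv₂ j k).const_smul c

/-- Increment of the Dirichlet integral. -/
lemma integral_gradient_sub (hf : DecaysC2 f) (hg : DecaysC2 g) :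
    (∫ x, ∑ j, ‖pderiv f j x‖ ^ 2) - ∫ x, ∑ j, ‖pderiv g j x‖ ^ 2
      = -(∫ x, ⟪Laplacian.laplacian f x, f x - g x⟫_ℝ)
        - ∫ x, ⟪Laplacian.laplacian g x, f x - g x⟫_ℝ := by
  have i : ∀ {a b : E n → ℂ}, DecaysC2 a → DecaysC2 b →
      Integrable fun x => ⟪Laplacian.laplacian a x, b x⟫_ℝ :=
    fun ha hb => (ha.decays_laplacian.inner hb.decays).integrable
  have e := integral_inner_laplacian hf hf
  have e' := integral_inner_laplacian hg hg
  simp only [real_inner_self_eq_norm_sq] at e e'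
  -- Symmetry of the Laplacian cancels the cross terms.
  have s : ∫ x, ⟪Laplacian.laplacian f x, g x⟫_ℝ = ∫ x, ⟪Laplacian.laplacian g x, f x⟫_ℝ := by
    rw [integral_inner_laplacian hf hg, integral_inner_laplacian hg hf]
    simp only [real_inner_comm]
  simp only [inner_sub_right]
  rw [integral_sub (i hf hf) (i hf hg), integral_sub (i hg hf) (i hg hg)]
  linarith

/-- Failure of symmetry of the virial form. -/
lemma virial_form_comm (hf : DecaysC2 f) (hg : DecaysC2 g) :
    ∫ x, ∑ j, x j * ⟪Complex.I * f x, pderiv g j x⟫_ℝ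
      = (∫ x, ∑ j, x j * ⟪Complex.I * g x, pderiv f j x⟫_ℝ)
        - n * ∫ x, ⟪Complex.I * f x, g x⟫_ℝ := by
  have i : ∀ {a b : E n → ℂ} (_ : DecaysC2 a) (_ : DecaysC2 b) (j : Fin n),
      Integrable fun x => x j * ⟪Complex.I * a x, pderiv b j x⟫_ℝ :=
    fun ha hb j => (ha.decays.I_mul.coord_inner (hb.decays_pderiv j) j).integrable
  rw [integral_finsetSum _ fun j _ => i hf hg j, integral_finsetSum _ fun j _ => i hg hf j]
  have key : ∀ j : Fin n, ∫ x, x j * ⟪Complex.I * f x, pderiv g j x⟫_ℝ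
      = (∫ x, x j * ⟪Complex.I * g x, pderiv f j x⟫_ℝ) - ∫ x, ⟪Complex.I * f x, g x⟫_ℝ := by
    intro j
    have hd : ∀ x, HasFDerivAt (fun x => ⟪Complex.I * f x, g x⟫_ℝ) _ x := fun x =>
      ((hf.differentiable x).hasFDerivAt.const_mul Complex.I).inner ℝ
        (hg.differentiable x).hasFDerivAt
    have e : ∀ x, fderiv ℝ (fun x => ⟪Complex.I * f x, g x⟫_ℝ) x
        (EuclideanSpace.single j (1 : ℝ))
        = ⟪Complex.I * f x, pderiv g j x⟫_ℝ - ⟪Complex.I * g x, pderiv f j x⟫_ℝ := by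
      intro x
      have : ⟪Complex.I * g x, pderiv f j x⟫_ℝ = -⟪Complex.I * pderiv f j x, g x⟫_ℝ := by
        rw [inner_I_mul_left, real_inner_comm]
      rw [this, sub_neg_eq_add, (hd x).fderiv]
      rfl
    have step := integral_coord_mul_fderiv j (fun x => (hd x).differentiableAt)
      (hf.decays.I_mul.inner hg.decays).integrable
      (by simp only [e, mul_sub]; exact (i hf hg j).sub (i hg hf j))
      (hf.decays.I_mul.coord_inner hg.decays j).integrable
    simp only [e, mul_sub] at step
    rw [integral_sub (i hf hg j) (i hg hf j)] at step
    linarith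
  simp only [key, Finset.sum_sub_distrib, Finset.sum_const, Finset.card_univ, Fintype.card_fin,
    nsmul_eq_mul]

end DecaysC2

/-! ### Convergence of first derivatives and of weighted integrals -/

/-- First-order Taylor estimate from two uses of the mean value inequality along the `j`-th
direction; the sharp factor `1/2` is not needed. -/
lemma norm_sub_sub_smul_pderiv_le {f : E n → ℂ} (hf : ContDiff ℝ 2 f) (j : Fin n) {K : ℝ}
    (hK : ∀ x, ‖pderiv (pderiv f j) j x‖ ≤ K) (x : E n) {δ : ℝ} (hδ : 0 < δ) :
    ‖f (x + δ • EuclideanSpace.single j (1 : ℝ)) - f x - δ • pderiv f j x‖ ≤ K * δ * δ := by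
  set e : E n := EuclideanSpace.single j (1 : ℝ) with he
  have line : ∀ s : ℝ, HasDerivAt (fun s : ℝ => x + s • e) e s := fun s => by
    simpa using ((hasDerivAt_id s).smul_const e).const_add x
  have along : ∀ {g : E n → ℂ}, Differentiable ℝ g → ∀ s : ℝ,
      HasDerivAt (fun s : ℝ => g (x + s • e)) (pderiv g j (x + s • e)) s := fun hg s =>
    (hg (x + s • e)).hasFDerivAt.comp_hasDerivAt s (line s)
  have hd : Differentiable ℝ f := hf.differentiable (by norm_num)
  have hd' : Differentiable ℝ (pderiv f j) := (pderiv_contDiff hf j).differentiable (by norm_num)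
  have hK0 : 0 ≤ K := (norm_nonneg _).trans (hK x)
  have first : ∀ s ∈ Set.Icc (0 : ℝ) δ, ‖pderiv f j (x + s • e) - pderiv f j x‖ ≤ K * δ := by
    intro s hs
    have h := Convex.norm_image_sub_le_of_norm_hasDerivWithin_le (C := K)
      (fun s _ => (along hd' s).hasDerivWithinAt) (fun s _ => hK _) (convex_Icc (0 : ℝ) δ)
      (Set.left_mem_Icc.2 hδ.le) hs
    simp only [zero_smul, add_zero, sub_zero, Real.norm_eq_abs, abs_of_nonneg hs.1] at h
    exact h.trans (mul_le_mul_of_nonneg_left hs.2 hK0)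
  have h := Convex.norm_image_sub_le_of_norm_hasDerivWithin_le (C := K * δ)
    (f := fun s : ℝ => f (x + s • e) - s • pderiv f j x)
    (f' := fun s : ℝ => pderiv f j (x + s • e) - pderiv f j x)
    (fun s _ => (((along hd s).sub
      (by simpa using (hasDerivAt_id s).smul_const (pderiv f j x)))).hasDerivWithinAt)
    first (convex_Icc (0 : ℝ) δ) (Set.left_mem_Icc.2 hδ.le) (Set.right_mem_Icc.2 hδ.le)
  simp only [zero_smul, add_zero, sub_zero, Real.norm_eq_abs, abs_of_pos hδ] at h
  rwa [sub_right_comm] at h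

/-- Pointwise convergence together with a uniform bound on second derivatives gives pointwise
convergence of first derivatives. -/
lemma tendsto_pderiv {v : ℝ → E n → ℂ} {l : Filter ℝ} {w : E n → ℂ} {K : ℝ} (j : Fin n)
    (hv : ∀ h, ContDiff ℝ 2 (v h)) (hw : ContDiff ℝ 2 w)
    (hvK : ∀ h x, ‖pderiv (pderiv (v h) j) j x‖ ≤ K) (hwK : ∀ x, ‖pderiv (pderiv w j) j x‖ ≤ K)
    (hlim : ∀ x, Tendsto (fun h => v h x) l (𝓝 (w x))) (x : E n) :
    Tendsto (fun h => pderiv (v h) j x) l (𝓝 (pderiv w j x)) := by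
  have hK0 : 0 ≤ K := (norm_nonneg _).trans (hwK x)
  rw [Metric.tendsto_nhds]
  intro ε hε
  -- The error splits into two Taylor remainders, each at most `Kδ² ≤ εδ/4`, and two differences of
  -- values, each below `εδ/4`. Using `K + 1` keeps the denominator positive when `K = 0`.
  set δ := ε / (4 * (K + 1)) with hδdef
  have hδ : 0 < δ := by positivity
  have hKδ : K * δ ≤ ε / 4 := by
    rw [hδdef, mul_div_assoc', div_le_div_iff₀ (by positivity) (by positivity)]
    nlinarith
  set y := x + δ • (EuclideanSpace.single j (1 : ℝ) : E n) with hy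
  filter_upwards [Metric.tendsto_nhds.1 (hlim x) (ε * δ / 4) (by positivity),
    Metric.tendsto_nhds.1 (hlim y) (ε * δ / 4) (by positivity)] with h h1 h2
  rw [dist_eq_norm] at h1 h2 ⊢
  have t1 := norm_sub_sub_smul_pderiv_le (hv h) j (hvK h) x hδ
  have t2 := norm_sub_sub_smul_pderiv_le hw j hwK x hδ
  rw [← hy] at t1 t2
  have split : δ • (pderiv (v h) j x - pderiv w j x)
      = (w y - w x - δ • pderiv w j x) - (v h y - v h x - δ • pderiv (v h) j x)
        + (v h y - w y) - (v h x - w x) := by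
    rw [smul_sub]
    abel
  have hle : δ * ‖pderiv (v h) j x - pderiv w j x‖ < δ * ε := by
    calc δ * ‖pderiv (v h) j x - pderiv w j x‖ = ‖δ • (pderiv (v h) j x - pderiv w j x)‖ := by
          rw [norm_smul, Real.norm_eq_abs, abs_of_pos hδ]
      _ ≤ ‖w y - w x - δ • pderiv w j x‖ + ‖v h y - v h x - δ • pderiv (v h) j x‖
          + ‖v h y - w y‖ + ‖v h x - w x‖ := by
          rw [split]
          refine (norm_sub_le _ _).trans (add_le_add_left ((norm_add_le _ _).trans
            (add_le_add_left (norm_sub_le _ _) _)) _)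
      _ < K * δ * δ + K * δ * δ + ε * δ / 4 + ε * δ / 4 := by linarith
      _ ≤ δ * ε := by nlinarith
  exact lt_of_mul_lt_mul_left hle hδ.le

lemma tendsto_integral_of_le_weight {l : Filter ℝ} [l.IsCountablyGenerated]
    {F : ℝ → E n → ℝ} {f : E n → ℝ} {C : ℝ} (hc : ∀ h, Continuous (F h))
    (hb : ∀ h x, |F h x| ≤ C * weight x) (hl : ∀ x, Tendsto (fun h => F h x) l (𝓝 (f x))) :
    Tendsto (fun h => ∫ x, F h x) l (𝓝 (∫ x, f x)) :=
  tendsto_integral_filter_of_dominated_convergence (fun x => C * weight x)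
    (Eventually.of_forall fun h => (hc h).aestronglyMeasurable)
    (Eventually.of_forall fun h => Eventually.of_forall (hb h))
    (integrable_weight.const_mul C) (Eventually.of_forall hl)

lemma hasDerivAt_integral_of_le_weight {F F' : ℝ → E n → ℝ} {C : ℝ}
    (hF : ∀ t, Decays (F t)) (hc : ∀ t, Continuous (F' t)) (hb : ∀ t x, |F' t x| ≤ C * weight x)
    (hd : ∀ t x, HasDerivAt (fun s => F s x) (F' t x) t) (t : ℝ) :
    HasDerivAt (fun t => ∫ x, F t x) (∫ x, F' t x) t :=
  (hasDerivAt_integral_of_dominated_loc_of_deriv_le (bound := fun x => C * weight x) univ_mem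
    (Eventually.of_forall fun s => (hF s).1.aestronglyMeasurable) (hF t).integrable
    (hc t).aestronglyMeasurable (Eventually.of_forall fun x s _ => hb s x)
    (integrable_weight.const_mul C) (Eventually.of_forall fun x s _ => hd s x)).2

lemma abs_inner_le_weight {a b : ℂ} {C D : ℝ} {x : E n} (ha : ‖a‖ ≤ C * weight x)
    (hb : ‖b‖ ≤ D * weight x) (hD : 0 ≤ D) :
    |⟪a, b⟫_ℝ| ≤ C * D * weight x := by
  have hw := weight_pos x
  have hCw : 0 ≤ C * weight x := (norm_nonneg a).trans ha
  calc |⟪a, b⟫_ℝ| ≤ ‖a‖ * ‖b‖ := abs_real_inner_le_norm a b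
    _ ≤ (C * weight x) * (D * 1) := by
      gcongr
      exact hb.trans (mul_le_mul_of_nonneg_left (weight_le_one x) hD)
    _ = _ := by ring

lemma abs_coord_inner_le_weight {a b : ℂ} {C D : ℝ} {x : E n} (j : Fin n)
    (ha : ‖a‖ ≤ C * weight x) (hb : ‖b‖ ≤ D * weight x) (hD : 0 ≤ D) :
    |x j * ⟪a, b⟫_ℝ| ≤ C * D * weight x := by
  have hw := weight_pos x
  have hCw : 0 ≤ C * weight x := (norm_nonneg a).trans ha
  rw [abs_mul]
  calc |x j| * |⟪a, b⟫_ℝ| ≤ |x j| * ((C * weight x) * (D * weight x)) := by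
        gcongr
        exact (abs_real_inner_le_norm a b).trans (by gcongr)
    _ = (|x j| * weight x) * ((C * weight x) * D) := by ring
    _ ≤ 1 * ((C * weight x) * D) := by
        gcongr
        exact abs_coord_mul_weight_le_one x j
    _ = _ := by ring

/-! ### Decaying solutions and their time difference quotients -/

/-- A classical solution whose spatial derivatives of order at most two decay uniformly in
time. -/
structure DecayingSolution (lam1 lam2 : ℝ) (u : ℝ → E n → ℂ) (C : ℝ) : Prop where
  sol : IsSolution lam1 lam2 u
  nonneg : 0 ≤ C
  bound : ∀ t x, ‖u t x‖ ≤ C * weight x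
  bound₁ : ∀ t j x, ‖pderiv (u t) j x‖ ≤ C * weight x
  bound₂ : ∀ t j k x, ‖pderiv (pderiv (u t) j) k x‖ ≤ C * weight x

/-- The time derivative. -/
def tderiv (u : ℝ → E n → ℂ) (t : ℝ) (x : E n) : ℂ := deriv (fun s => u s x) t

/-- The time difference quotient. -/
def tquot (u : ℝ → E n → ℂ) (t h : ℝ) (x : E n) : ℂ := h⁻¹ • (u (t + h) x - u t x)

namespace DecayingSolution

variable {u : ℝ → E n → ℂ} {C : ℝ}

lemma decaysC2 (hu : DecayingSolution lam1 lam2 u C) (t : ℝ) : DecaysC2 (u t) := by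
  have h2 := hu.sol.1 t
  have h1 : ∀ j, ContDiff ℝ 1 (pderiv (u t) j) := pderiv_contDiff h2
  exact ⟨h2, ⟨h2.continuous, C, hu.nonneg, hu.bound t⟩,
    fun j => ⟨(h1 j).continuous, C, hu.nonneg, hu.bound₁ t j⟩,
    fun j k => ⟨((h1 j).continuous_fderiv (by norm_num)).clm_apply continuous_const,
      C, hu.nonneg, hu.bound₂ t j k⟩⟩

lemma hasDerivAt (hu : DecayingSolution lam1 lam2 u C) (t : ℝ) (x : E n) :
    HasDerivAt (fun s => u s x) (tderiv u t x) t :=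
  (hu.sol.2 t x).1.hasDerivAt

lemma I_mul_tderiv (hu : DecayingSolution lam1 lam2 u C) (t : ℝ) (x : E n) :
    Complex.I * tderiv u t x = nonlin lam1 lam2 (u t x) - Laplacian.laplacian (u t) x := by
  rw [← (hu.sol.2 t x).2, tderiv, add_sub_cancel_right]

lemma tderiv_eq (hu : DecayingSolution lam1 lam2 u C) (t : ℝ) (x : E n) :
    tderiv u t x = Complex.I * (Laplacian.laplacian (u t) x - nonlin lam1 lam2 (u t x)) := by
  rw [← neg_sub, ← hu.I_mul_tderiv t x, mul_neg, ← mul_assoc, Complex.I_mul_I]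
  ring

lemma norm_laplacian_le (hu : DecayingSolution lam1 lam2 u C) (t : ℝ) (x : E n) :
    ‖Laplacian.laplacian (u t) x‖ ≤ n * C * weight x := by
  rw [laplacian_eq_sum_pderiv (hu.sol.1 t)]
  refine (norm_sum_le _ _).trans ((Finset.sum_le_sum fun j _ => hu.bound₂ t j j x).trans ?_)
  simp [mul_assoc]

lemma exists_norm_nonlin_le (hu : DecayingSolution lam1 lam2 u C) :
    ∃ D, 0 ≤ D ∧ ∀ t x, ‖nonlin lam1 lam2 (u t x)‖ ≤ D * weight x := by
  have hC := hu.nonneg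
  refine ⟨(|lam1| * C ^ 2 + |lam2| * C ^ 4) * C, by positivity, fun t x => ?_⟩
  have hb : ‖u t x‖ ≤ C :=
    (hu.bound t x).trans (mul_le_of_le_one_right hC (weight_le_one x))
  refine (norm_nonlin_le hb).trans ?_
  rw [mul_assoc]
  gcongr
  exact hu.bound t x

lemma exists_norm_tderiv_le (hu : DecayingSolution lam1 lam2 u C) :
    ∃ D, 0 ≤ D ∧ ∀ t x, ‖tderiv u t x‖ ≤ D * weight x := by
  obtain ⟨D, hD0, hD⟩ := hu.exists_norm_nonlin_le
  have hC := hu.nonneg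
  refine ⟨n * C + D, by positivity, fun t x => ?_⟩
  rw [hu.tderiv_eq, norm_mul, Complex.norm_I, one_mul, add_mul]
  exact (norm_sub_le _ _).trans (add_le_add (hu.norm_laplacian_le t x) (hD t x))

lemma decays_tderiv (hu : DecayingSolution lam1 lam2 u C) (t : ℝ) : Decays (tderiv u t) := by
  rw [funext (hu.tderiv_eq t)]
  exact ((hu.decaysC2 t).decays_laplacian.sub ((hu.decaysC2 t).decays.nonlin _ _)).I_mul

lemma decaysC2_tquot (hu : DecayingSolution lam1 lam2 u C) (t h : ℝ) :
    DecaysC2 (tquot u t h) :=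
  ((hu.decaysC2 (t + h)).sub (hu.decaysC2 t)).const_smul h⁻¹

lemma tendsto_tquot (hu : DecayingSolution lam1 lam2 u C) (t : ℝ) (x : E n) :
    Tendsto (fun h => tquot u t h x) (𝓝[≠] 0) (𝓝 (tderiv u t x)) := by
  simpa only [tquot] using hasDerivAt_iff_tendsto_slope_zero.1 (hu.hasDerivAt t x)

/-- The mean value inequality in time gives a bound uniform in `h`, so it can serve as the
dominating function in every limit `h → 0`. At `h = 0` the quotient is zero since `0⁻¹ = 0`. -/
lemma norm_tquot_le (hu : DecayingSolution lam1 lam2 u C) {D : ℝ} (hD0 : 0 ≤ D)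
    (hD : ∀ t x, ‖tderiv u t x‖ ≤ D * weight x) (t h : ℝ) (x : E n) :
    ‖tquot u t h x‖ ≤ D * weight x := by
  have hw := weight_pos x
  have := Convex.norm_image_sub_le_of_norm_hasDerivWithin_le (C := D * weight x)
    (fun s _ => (hu.hasDerivAt s x).hasDerivWithinAt) (fun s _ => hD s x) convex_univ
    (Set.mem_univ t) (Set.mem_univ (t + h))
  rw [add_sub_cancel_left] at this
  rw [tquot, norm_smul, norm_inv]
  rcases eq_or_ne h 0 with rfl | hh
  · simp only [norm_zero, inv_zero, zero_mul]
    positivity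
  · rw [inv_mul_le_iff₀ (norm_pos_iff.2 hh), mul_comm]
    exact this

lemma tendsto_add (hu : DecayingSolution lam1 lam2 u C) (t : ℝ) (x : E n) :
    Tendsto (fun h => u (t + h) x) (𝓝[≠] 0) (𝓝 (u t x)) := by
  have h : Tendsto (fun h : ℝ => t + h) (𝓝[≠] 0) (𝓝 t) := by
    have : Tendsto (fun h : ℝ => t + h) (𝓝 0) (𝓝 (t + 0)) := by
      exact (continuous_const.add continuous_id).tendsto 0
    rw [add_zero] at this
    exact this.mono_left nhdsWithin_le_nhds
  exact (hu.hasDerivAt t x).continuousAt.tendsto.comp h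

lemma tendsto_pderiv_add (hu : DecayingSolution lam1 lam2 u C) (t : ℝ) (j : Fin n) (x : E n) :
    Tendsto (fun h => pderiv (u (t + h)) j x) (𝓝[≠] 0) (𝓝 (pderiv (u t) j x)) := by
  have hb : ∀ s x, ‖pderiv (pderiv (u s) j) j x‖ ≤ C := fun s x =>
    (hu.bound₂ s j j x).trans (mul_le_of_le_one_right hu.nonneg (weight_le_one x))
  exact tendsto_pderiv j (fun h => hu.sol.1 (t + h)) (hu.sol.1 t) (fun h x => hb _ x) (hb t)
    (hu.tendsto_add t) x

end DecayingSolution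

lemma pderiv_I_mul {f : E n → ℂ} (hf : Differentiable ℝ f) (j : Fin n) :
    pderiv (fun x => Complex.I * f x) j = fun x => Complex.I * pderiv f j x := by
  funext x
  have h : HasFDerivAt (fun x => Complex.I * f x) _ x := (hf x).hasFDerivAt.const_mul Complex.I
  rw [pderiv, h.fderiv]
  rfl

lemma DecaysC2.I_mul {f : E n → ℂ} (hf : DecaysC2 f) : DecaysC2 fun x => Complex.I * f x := by
  refine ⟨contDiff_const.mul hf.contDiff, hf.decays.I_mul, fun j => ?_, fun j k => ?_⟩
  · rw [pderiv_I_mul hf.differentiable]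
    exact (hf.decays_pderiv j).I_mul
  · rw [pderiv_I_mul hf.differentiable, pderiv_I_mul (hf.differentiable_pderiv j)]
    exact (hf.decays_pderiv₂ j k).I_mul

/-! ### Time derivatives of the Dirichlet and potential energies -/

namespace DecayingSolution

variable {u : ℝ → E n → ℂ} {C : ℝ}

/-- Interpolation controls the gradient in the limit but not the Laplacian, for lack of bounds on
third derivatives. Green's identity shifts one derivative onto `g`, so convergence of gradients
suffices. -/
lemma tendsto_integral_inner_laplacian_of_decaysC2 (hu : DecayingSolution lam1 lam2 u C) (t : ℝ)
    {g : E n → ℂ} (hg : DecaysC2 g) :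
    Tendsto (fun h => ∫ x, ⟪Laplacian.laplacian (u (t + h)) x, g x⟫_ℝ) (𝓝[≠] 0)
      (𝓝 (∫ x, ⟪Laplacian.laplacian (u t) x, g x⟫_ℝ)) := by
  simp only [fun s => DecaysC2.integral_inner_laplacian (hu.decaysC2 s) hg]
  choose D hD0 hD using fun j => (hg.decays_pderiv j).2
  refine (tendsto_integral_of_le_weight (C := ∑ j, C * D j) (fun h => ?_) (fun h x => ?_)
    fun x => ?_).neg
  · exact continuous_finsetSum _ fun j _ =>
      ((hu.decaysC2 (t + h)).decays_pderiv j).1.inner (hg.decays_pderiv j).1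
  · rw [Finset.sum_mul]
    exact (Finset.abs_sum_le_sum_abs _ _).trans (Finset.sum_le_sum fun j _ =>
      abs_inner_le_weight (hu.bound₁ _ j x) (hD j x) (hD0 j))
  · exact tendsto_finsetSum _ fun j _ => (hu.tendsto_pderiv_add t j x).inner tendsto_const_nhds

/-- Weak continuity in time of the Laplacian, tested against the time derivative. -/
lemma tendsto_integral_inner_laplacian_tderiv (hu : DecayingSolution lam1 lam2 u C) (t : ℝ) :
    Tendsto (fun h => ∫ x, ⟪Laplacian.laplacian (u (t + h)) x, tderiv u t x⟫_ℝ) (𝓝[≠] 0)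
      (𝓝 (∫ x, ⟪Laplacian.laplacian (u t) x, tderiv u t x⟫_ℝ)) := by
  obtain ⟨D, hD0, hD⟩ := hu.exists_norm_tderiv_le
  have hC := hu.nonneg
  have hdiff : ∀ k, Decays fun x => tderiv u t x - tquot u t k x := fun k =>
    (hu.decays_tderiv t).sub (hu.decaysC2_tquot t k).decays
  -- The time derivative is not known to be differentiable in space, so Green's identity cannot be
  -- tested against it. It is approximated in `L¹` by the `C²` quotients `tquot u t k`, at a cost
  -- controlled by the uniform bound `n * C` on the Laplacian.
  have happrox : Tendsto (fun k => ∫ x, n * C * ‖tderiv u t x - tquot u t k x‖) (𝓝[≠] 0)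
      (𝓝 (∫ _ : E n, n * C * ‖(0 : ℂ)‖)) := by
    refine tendsto_integral_of_le_weight (C := n * C * (D + D))
      (fun k => continuous_const.mul (hdiff k).1.norm) (fun k x => ?_) fun x => ?_
    · rw [abs_of_nonneg (by positivity), mul_assoc _ (D + D), add_mul]
      gcongr
      exact (norm_sub_le _ _).trans (add_le_add (hD t x) (hu.norm_tquot_le hD0 hD t k x))
    · have := (tendsto_const_nhds (x := tderiv u t x)).sub (hu.tendsto_tquot t x)
      rw [sub_self] at this
      exact this.norm.const_mul _
  simp only [norm_zero, mul_zero, integral_zero] at happrox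
  have hclose : ∀ s k, |(∫ x, ⟪Laplacian.laplacian (u s) x, tderiv u t x⟫_ℝ)
      - ∫ x, ⟪Laplacian.laplacian (u s) x, tquot u t k x⟫_ℝ|
      ≤ ∫ x, n * C * ‖tderiv u t x - tquot u t k x‖ := by
    intro s k
    have hL := (hu.decaysC2 s).decays_laplacian
    rw [← integral_sub (hL.inner (hu.decays_tderiv t)).integrable
      (hL.inner (hu.decaysC2_tquot t k).decays).integrable]
    simp only [← inner_sub_right]
    refine abs_integral_le_integral_abs.trans (integral_mono (hL.inner (hdiff k)).integrable.abs
      ((hdiff k).integrable.norm.const_mul _) fun x => ?_)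
    refine (abs_real_inner_le_norm _ _).trans
      (mul_le_mul_of_nonneg_right ((hu.norm_laplacian_le s x).trans ?_) (norm_nonneg _))
    exact mul_le_of_le_one_right (by positivity) (weight_le_one x)
  rw [Metric.tendsto_nhds]
  intro ε hε
  -- The approximation error is uniform in time, so `k` can be fixed before `h` tends to zero.
  obtain ⟨k, hk⟩ := (happrox.eventually (gt_mem_nhds (show 0 < ε / 3 by positivity))).exists
  filter_upwards [Metric.tendsto_nhds.1 (hu.tendsto_integral_inner_laplacian_of_decaysC2 t
    (hu.decaysC2_tquot t k)) (ε / 3) (by positivity)] with h hh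
  have h1 := abs_le.1 (hclose (t + h) k)
  have h2 := abs_le.1 (hclose t k)
  rw [Real.dist_eq] at hh ⊢
  rw [abs_lt] at hh ⊢
  constructor <;> linarith

/-- By `integral_gradient_sub`, the difference quotient is minus the pairing of `Δu(t+h) + Δu(t)`
with `tquot u t h`, which involves no mixed derivative. In the moving term, the quotient is first
replaced by its limit, and then weak continuity of the Laplacian applies. -/
lemma hasDerivAt_gradient (hu : DecayingSolution lam1 lam2 u C) (t : ℝ) :
    HasDerivAt (fun t => ∫ x, ∑ j, ‖pderiv (u t) j x‖ ^ 2)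
      (-2 * ∫ x, ⟪Laplacian.laplacian (u t) x, tderiv u t x⟫_ℝ) t := by
  obtain ⟨D, hD0, hD⟩ := hu.exists_norm_tderiv_le
  have hC := hu.nonneg
  rw [hasDerivAt_iff_tendsto_slope_zero]
  have hL := fun s => (hu.decaysC2 s).decays_laplacian
  have hq := fun h => (hu.decaysC2_tquot t h).decays
  have hdiff := fun h => (hq h).sub (hu.decays_tderiv t)
  have a1 : Tendsto (fun h => ∫ x, ⟪Laplacian.laplacian (u (t + h)) x,
      tquot u t h x - tderiv u t x⟫_ℝ) (𝓝[≠] 0) (𝓝 (∫ _ : E n, (0 : ℝ))) := by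
    refine tendsto_integral_of_le_weight (C := n * C * (D + D))
      (fun h => (hL _).1.inner (hdiff h).1) (fun h x => ?_) fun x => ?_
    · refine abs_inner_le_weight (hu.norm_laplacian_le _ x) ?_ (by positivity)
      rw [add_mul]
      exact (norm_sub_le _ _).trans (add_le_add (hu.norm_tquot_le hD0 hD t h x) (hD t x))
    · have h0 := (hu.tendsto_tquot t x).sub (tendsto_const_nhds (x := tderiv u t x))
      rw [sub_self] at h0
      have h1 := h0.norm.const_mul (n * C)
      rw [norm_zero, mul_zero] at h1
      refine squeeze_zero_norm (fun h => (norm_inner_le_norm _ _).trans ?_) h1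
      refine mul_le_mul_of_nonneg_right ((hu.norm_laplacian_le _ x).trans ?_) (norm_nonneg _)
      exact mul_le_of_le_one_right (by positivity) (weight_le_one x)
  have a2 := hu.tendsto_integral_inner_laplacian_tderiv t
  have a3 : Tendsto (fun h => ∫ x, ⟪Laplacian.laplacian (u t) x, tquot u t h x⟫_ℝ) (𝓝[≠] 0)
      (𝓝 (∫ x, ⟪Laplacian.laplacian (u t) x, tderiv u t x⟫_ℝ)) :=
    tendsto_integral_of_le_weight (C := n * C * D) (fun h => (hL t).1.inner (hq h).1)
      (fun h x => abs_inner_le_weight (hu.norm_laplacian_le _ x)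
        (hu.norm_tquot_le hD0 hD t h x) hD0)
      fun x => tendsto_const_nhds.inner (hu.tendsto_tquot t x)
  have key := ((a1.add a2).add a3).neg
  rw [integral_zero, zero_add, ← two_mul, ← neg_mul] at key
  refine key.congr fun h => ?_
  rw [DecaysC2.integral_gradient_sub (hu.decaysC2 (t + h)) (hu.decaysC2 t), smul_eq_mul, mul_sub, mul_neg,
    ← integral_const_mul, ← integral_const_mul]
  simp only [← real_inner_smul_right]
  change _ = -(∫ x, ⟪_, tquot u t h x⟫_ℝ) - ∫ x, ⟪_, tquot u t h x⟫_ℝ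
  simp only [inner_sub_right]
  rw [integral_sub ((hL _).inner (hq h)).integrable ((hL _).inner (hu.decays_tderiv t)).integrable]
  ring

lemma hasDerivAt_potential (hu : DecayingSolution lam1 lam2 u C) (t : ℝ) :
    HasDerivAt (fun t => ∫ x, potential lam1 lam2 (u t x))
      (∫ x, ⟪nonlin lam1 lam2 (u t x), tderiv u t x⟫_ℝ) t := by
  obtain ⟨D, hD0, hD⟩ := hu.exists_norm_tderiv_le
  obtain ⟨N, hN0, hN⟩ := hu.exists_norm_nonlin_le
  exact hasDerivAt_integral_of_le_weight (C := N * D)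
    (fun t => (hu.decaysC2 t).decays.potential lam1 lam2)
    (fun t => ((hu.decaysC2 t).decays.nonlin lam1 lam2).1.inner (hu.decays_tderiv t).1)
    (fun t x => abs_inner_le_weight (hN t x) (hD t x) hD0)
    (fun t x => HasFDerivAt.comp_hasDerivAt (f := fun s => u s x) t
      (hasFDerivAt_potential lam1 lam2 (u t x)) (hu.hasDerivAt t x)) t

end DecayingSolution

/-! ### Conservation laws and the virial identity -/

lemma DecaysC2.energy_eq {f : E n → ℂ} (hf : DecaysC2 f) (lam1 lam2 : ℝ) :
    energy lam1 lam2 f = (∫ x, ∑ j, ‖pderiv f j x‖ ^ 2) + 2 * ∫ x, potential lam1 lam2 (f x) := by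
  have i1 : Integrable fun x => ∑ j, ‖pderiv f j x‖ ^ 2 :=
    integrable_finsetSum _ fun j _ => (hf.decays_pderiv j).norm_sq.integrable
  have i2 : Integrable fun x => potential lam1 lam2 (f x) :=
    (hf.decays.potential lam1 lam2).integrable
  rw [← integral_const_mul, ← integral_add i1 (i2.const_mul 2)]
  refine integral_congr_ae (Eventually.of_forall fun x => ?_)
  simp only [potential]
  ring

namespace DecayingSolution

variable {u : ℝ → E n → ℂ} {C : ℝ}

/-- Conservation of energy. -/
lemma energy_eq (hu : DecayingSolution lam1 lam2 u C) (t s : ℝ) :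
    energy lam1 lam2 (u t) = energy lam1 lam2 (u s) := by
  have hd : ∀ t, HasDerivAt (fun t => energy lam1 lam2 (u t)) 0 t := by
    intro t
    rw [funext fun t => (hu.decaysC2 t).energy_eq lam1 lam2]
    refine ((hu.hasDerivAt_gradient t).add ((hu.hasDerivAt_potential t).const_mul 2)).congr_deriv ?_
    have i1 := ((hu.decaysC2 t).decays_laplacian.inner (hu.decays_tderiv t)).integrable
    have i2 := (((hu.decaysC2 t).decays.nonlin lam1 lam2).inner (hu.decays_tderiv t)).integrable
    -- The energy derivative is twice the integral of `⟪N(u) - Δu, uₜ⟫ = ⟪i uₜ, uₜ⟫`, where `N`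
    -- denotes the nonlinearity; this vanishes pointwise.
    have h := integral_sub i2 i1
    simp only [← inner_sub_left, ← hu.I_mul_tderiv, inner_I_mul_self, integral_zero] at h
    linarith
  exact is_const_of_deriv_eq_zero (fun t => (hd t).differentiableAt) (fun t => (hd t).deriv) t s

/-- Conservation of mass. -/
lemma mass_eq (hu : DecayingSolution lam1 lam2 u C) (t s : ℝ) : mass (u t) = mass (u s) := by
  obtain ⟨D, hD0, hD⟩ := hu.exists_norm_tderiv_le
  have hd : ∀ t, HasDerivAt (fun t => mass (u t)) 0 t := by
    intro t
    have h := hasDerivAt_integral_of_le_weight (F := fun t x => ‖u t x‖ ^ 2)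
      (F' := fun t x => 2 * ⟪u t x, tderiv u t x⟫_ℝ) (C := 2 * (C * D))
      (fun t => (hu.decaysC2 t).decays.norm_sq)
      (fun t => continuous_const.mul ((hu.decaysC2 t).decays.1.inner (hu.decays_tderiv t).1))
      (fun t x => by
        rw [abs_mul, abs_two, mul_assoc]
        gcongr
        exact abs_inner_le_weight (hu.bound t x) (hD t x) hD0)
      (fun t x => (hu.hasDerivAt t x).norm_sq) t
    refine h.congr_deriv ?_
    -- The nonlinearity is a real multiple of `u` and drops out; Green's identity then reduces the
    -- rest to `⟪∂ⱼu, i ∂ⱼu⟫ = 0`.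
    have e : ∀ x, 2 * ⟪u t x, tderiv u t x⟫_ℝ
        = -2 * ⟪Laplacian.laplacian (u t) x, Complex.I * u t x⟫_ℝ := by
      intro x
      rw [hu.tderiv_eq, mul_sub, inner_sub_right, nonlin_eq_smul, mul_smul_comm,
        real_inner_smul_right, ← neg_eq_iff_eq_neg.2 (inner_I_mul_left (u t x) (u t x)),
        inner_I_mul_self, real_inner_comm _ (Laplacian.laplacian (u t) x), inner_I_mul_left]
      ring
    simp only [e]
    rw [integral_const_mul,
      DecaysC2.integral_inner_laplacian (hu.decaysC2 t) (hu.decaysC2 t).I_mul]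
    simp only [pderiv_I_mul (hu.decaysC2 t).differentiable]
    simp only [real_inner_comm (Complex.I * _), inner_I_mul_self, Finset.sum_const_zero,
      integral_zero, neg_zero, mul_zero]
  exact is_const_of_deriv_eq_zero (fun t => (hd t).differentiableAt) (fun t => (hd t).deriv) t s

lemma pderiv_tquot (hu : DecayingSolution lam1 lam2 u C) (t h : ℝ) (j : Fin n) (x : E n) :
    pderiv (tquot u t h) j x = h⁻¹ • (pderiv (u (t + h)) j x - pderiv (u t) j x) := by
  have hd := ((hu.decaysC2 (t + h)).differentiable x).hasFDerivAt.sub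
    ((hu.decaysC2 t).differentiable x).hasFDerivAt
  have hd' : HasFDerivAt (tquot u t h) _ x := hd.const_smul h⁻¹
  rw [pderiv, hd'.fderiv]
  rfl

/-- The virial identity. -/
lemma hasDerivAt_virial_form (hu : DecayingSolution lam1 lam2 u C) (t : ℝ) :
    HasDerivAt (fun t => ∫ x, ∑ j, x j * ⟪Complex.I * u t x, pderiv (u t) j x⟫_ℝ)
      (2 * (∫ x, ∑ j, ‖pderiv (u t) j x‖ ^ 2)
        + n * ∫ x, (lam1 / 2 * ‖u t x‖ ^ 4 - 2 * lam2 / 3 * ‖u t x‖ ^ 6)) t := by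
  obtain ⟨D, hD0, hD⟩ := hu.exists_norm_tderiv_le
  have hC := hu.nonneg
  have hs := hu.decaysC2
  have hq := hu.decaysC2_tquot t
  have hform : ∀ {a : E n → ℂ} {f : E n → ℂ}, Decays a → DecaysC2 f →
      Decays fun x => ∑ j, x j * ⟪Complex.I * a x, pderiv f j x⟫_ℝ := fun ha hf =>
    Decays.sum _ fun j _ => ha.I_mul.coord_inner (hf.decays_pderiv j) j
  have hbound : ∀ h s x, |∑ j, x j * ⟪Complex.I * tquot u t h x, pderiv (u s) j x⟫_ℝ|
      ≤ (n * (D * C)) * weight x := by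
    intro h s x
    refine (Finset.abs_sum_le_sum_abs _ _).trans ((Finset.sum_le_sum fun j _ =>
      abs_coord_inner_le_weight (C := D) (D := C) j ?_ (hu.bound₁ s j x) hC).trans ?_)
    · simpa using hu.norm_tquot_le hD0 hD t h x
    · simp [mul_assoc]
  have a1 : Tendsto (fun h => ∫ x, ∑ j, x j * ⟪Complex.I * tquot u t h x,
      pderiv (u (t + h)) j x⟫_ℝ) (𝓝[≠] 0)
      (𝓝 (∫ x, ∑ j, x j * ⟪Complex.I * tderiv u t x, pderiv (u t) j x⟫_ℝ)) :=
    tendsto_integral_of_le_weight (fun h => (hform (hq h).decays (hs _)).1)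
      (fun h x => hbound h _ x) fun x => tendsto_finsetSum _ fun j _ =>
      (((hu.tendsto_tquot t x).const_mul Complex.I).inner
        (hu.tendsto_pderiv_add t j x)).const_mul _
  have a2 : Tendsto (fun h => ∫ x, ∑ j, x j * ⟪Complex.I * tquot u t h x,
      pderiv (u t) j x⟫_ℝ) (𝓝[≠] 0)
      (𝓝 (∫ x, ∑ j, x j * ⟪Complex.I * tderiv u t x, pderiv (u t) j x⟫_ℝ)) :=
    tendsto_integral_of_le_weight (fun h => (hform (hq h).decays (hs _)).1)
      (fun h x => hbound h _ x) fun x => tendsto_finsetSum _ fun j _ =>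
      (((hu.tendsto_tquot t x).const_mul Complex.I).inner tendsto_const_nhds).const_mul _
  have a3 : Tendsto (fun h => ∫ x, ⟪Complex.I * u t x, tquot u t h x⟫_ℝ) (𝓝[≠] 0)
      (𝓝 (∫ x, ⟪Complex.I * u t x, tderiv u t x⟫_ℝ)) :=
    tendsto_integral_of_le_weight (C := C * D)
      (fun h => (hs t).decays.I_mul.1.inner (hq h).decays.1)
      (fun h x => abs_inner_le_weight (by simpa using hu.bound t x)
        (hu.norm_tquot_le hD0 hD t h x) hD0)
      fun x => tendsto_const_nhds.inner (hu.tendsto_tquot t x)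
  -- With `B(a, f) = ∫ x·⟪i a, ∇f⟫` and `q = tquot u t h`, the virial quotient is `B(q, u(t+h)) +
  -- B(u(t), q)`. By `virial_form_comm` the second term becomes `B(q, u(t)) - n ∫ ⟪i u(t), q⟫`, so
  -- `q` is never differentiated.
  have key := a1.add (a2.sub (a3.const_mul (n : ℝ)))
  have hd : HasDerivAt (fun t => ∫ x, ∑ j, x j * ⟪Complex.I * u t x, pderiv (u t) j x⟫_ℝ) _ t :=
    hasDerivAt_iff_tendsto_slope_zero.2 <| key.congr fun h => by
      rw [← DecaysC2.virial_form_comm (hs t) (hq h),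
        ← integral_add (hform (hq h).decays (hs (t + h))).integrable
          (hform (hs t).decays (hq h)).integrable,
        ← integral_sub (hform (hs (t + h)).decays (hs (t + h))).integrable
          (hform (hs t).decays (hs t)).integrable, smul_eq_mul, ← integral_const_mul]
      refine integral_congr_ae (Eventually.of_forall fun x => ?_)
      simp only [← Finset.sum_add_distrib, ← Finset.sum_sub_distrib, Finset.mul_sum]
      refine Finset.sum_congr rfl fun j _ => ?_
      rw [hu.pderiv_tquot, tquot, mul_smul_comm, mul_sub, real_inner_smul_left,
        real_inner_smul_right, inner_sub_left, inner_sub_right]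
      ring
  refine hd.congr_deriv ?_
  -- Substituting the equation for `i uₜ` leaves the virial integral of the nonlinearity minus the
  -- Pohozaev integral.
  have e1 : ∫ x, ∑ j, x j * ⟪Complex.I * tderiv u t x, pderiv (u t) j x⟫_ℝ
      = -(n : ℝ) * (∫ x, potential lam1 lam2 (u t x))
        - ((n : ℝ) / 2 - 1) * ∫ x, ∑ j, ‖pderiv (u t) j x‖ ^ 2 := by
    rw [← (hs t).integral_coord_inner_nonlin, ← (hs t).integral_coord_inner_laplacian,
      ← integral_sub]
    · refine integral_congr_ae (Eventually.of_forall fun x => ?_)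
      simp only [hu.I_mul_tderiv, inner_sub_left, mul_sub, Finset.sum_sub_distrib]
    · exact integrable_finsetSum _ fun j _ =>
        (((hs t).decays.nonlin lam1 lam2).coord_inner ((hs t).decays_pderiv j) j).integrable
    · exact integrable_finsetSum _ fun j _ =>
        ((hs t).decays_laplacian.coord_inner ((hs t).decays_pderiv j) j).integrable
  have i4 := ((hs t).decays.norm_pow 3).integrable
  have i6 := ((hs t).decays.norm_pow 5).integrable
  have iN : Integrable fun x => ⟪nonlin lam1 lam2 (u t x), u t x⟫_ℝ :=
    (((hs t).decays.nonlin lam1 lam2).inner (hs t).decays).integrable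
  have e2 : ∫ x, ⟪Complex.I * u t x, tderiv u t x⟫_ℝ
      = -(∫ x, ⟪nonlin lam1 lam2 (u t x), u t x⟫_ℝ) - ∫ x, ∑ j, ‖pderiv (u t) j x‖ ^ 2 := by
    have green := DecaysC2.integral_inner_laplacian (hs t) (hs t)
    simp only [real_inner_self_eq_norm_sq] at green
    rw [sub_eq_add_neg, ← green, neg_add_eq_sub,
      ← integral_sub ((hs t).decays_laplacian.inner (hs t).decays).integrable iN]
    refine integral_congr_ae (Eventually.of_forall fun x => ?_)
    simp only [inner_I_mul_left, hu.I_mul_tderiv, ← inner_sub_left]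
    rw [real_inner_comm, ← inner_neg_left, neg_sub]
  have e3 : ∫ x, potential lam1 lam2 (u t x)
      = lam1 / 4 * (∫ x, ‖u t x‖ ^ 4) - lam2 / 6 * ∫ x, ‖u t x‖ ^ 6 := by
    simp only [potential]
    rw [integral_sub (i4.const_mul _) (i6.const_mul _), integral_const_mul, integral_const_mul]
  have e4 : ∫ x, ⟪nonlin lam1 lam2 (u t x), u t x⟫_ℝ
      = lam1 * (∫ x, ‖u t x‖ ^ 4) - lam2 * ∫ x, ‖u t x‖ ^ 6 := by
    simp only [inner_nonlin_self]
    rw [integral_sub (i4.const_mul _) (i6.const_mul _), integral_const_mul, integral_const_mul]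
  have e5 : ∫ x, (lam1 / 2 * ‖u t x‖ ^ 4 - 2 * lam2 / 3 * ‖u t x‖ ^ 6)
      = lam1 / 2 * (∫ x, ‖u t x‖ ^ 4) - 2 * lam2 / 3 * ∫ x, ‖u t x‖ ^ 6 := by
    rw [integral_sub (i4.const_mul _) (i6.const_mul _), integral_const_mul, integral_const_mul]
  rw [e1, e2, e3, e4, e5]
  ring

end DecayingSolution

/-- Pointwise, `Im(f̄ ∂ⱼf) = ⟪i f, ∂ⱼf⟫`; integrability allows the imaginary part to pass inside the
integral. -/
lemma DecaysC2.virial_eq {f : E n → ℂ} (hf : DecaysC2 f) :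
    virial f = ∫ x, ∑ j, x j * ⟪Complex.I * f x, pderiv f j x⟫_ℝ := by
  have hi : Integrable fun x : E n =>
      ∑ j, (x j : ℂ) * ((starRingEnd ℂ) (f x) * pderiv f j x) := by
    refine integrable_finsetSum _ fun j _ => ?_
    obtain ⟨-, C, hC0, hC⟩ := id hf.decays
    refine ((hf.decays_pderiv j).of_norm_le (K := C) ?_ hC0 fun x => ?_).integrable
    · exact (Complex.continuous_ofReal.comp (by fun_prop)).mul
        ((Complex.continuous_conj.comp hf.decays.1).mul (hf.decays_pderiv j).1)
    · rw [norm_mul, norm_mul, Complex.norm_real, Real.norm_eq_abs, RCLike.norm_conj, ← mul_assoc]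
      gcongr
      calc |x j| * ‖f x‖ ≤ |x j| * (C * weight x) := by gcongr; exact hC x
        _ = C * (|x j| * weight x) := by ring
        _ ≤ C * 1 := by gcongr; exact abs_coord_mul_weight_le_one x j
        _ = C := mul_one C
  have h := Complex.imCLM.integral_comp_comm hi
  simp only [Complex.imCLM_apply] at h
  rw [virial, ← h]
  refine integral_congr_ae (Eventually.of_forall fun x => ?_)
  simp only [Complex.im_sum]
  refine Finset.sum_congr rfl fun j _ => ?_
  rw [Complex.im_ofReal_mul]
  congr 1
  simp [Complex.inner]
  ring

lemma DecayingSolution.hasDerivAt_virial {u : ℝ → E n → ℂ} {C : ℝ}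
    (hu : DecayingSolution lam1 lam2 u C) (t : ℝ) :
    HasDerivAt (fun t => virial (u t))
      (2 * (∫ x, ∑ j, ‖pderiv (u t) j x‖ ^ 2)
        + n * ∫ x, (lam1 / 2 * ‖u t x‖ ^ 4 - 2 * lam2 / 3 * ‖u t x‖ ^ 6)) t := by
  rw [funext fun t => (hu.decaysC2 t).virial_eq]
  exact hu.hasDerivAt_virial_form t

/-! ### From breathers to a critical time of the virial -/

/-- The exponential decay of the profile and of the perturbation passes to the breather. -/
lemma IsBreather.exists_decayingSolution {u : ℝ → E n → ℂ} (hB : IsBreather lam1 lam2 u)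
    (hu : IsSolution lam1 lam2 u) : ∃ C, DecayingSolution lam1 lam2 u C := by
  obtain ⟨ω, Q, z, -, ⟨hQ, -, hQd⟩, huz, -, -, -, hz, hzd⟩ := hB
  have bound : ∀ j ≤ 2, ∃ C, 0 ≤ C ∧ ∀ t x, ‖iteratedFDeriv ℝ j (u t) x‖ ≤ C * weight x := by
    intro j hj
    obtain ⟨A, α, hA, hα, hAb⟩ := hQd j hj
    obtain ⟨B, β, hB, hβ, hBb⟩ := hzd j hj
    obtain ⟨A', hA', hAw⟩ := exp_le_weight (n := n) hα
    obtain ⟨B', hB', hBw⟩ := exp_le_weight (n := n) hβ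
    refine ⟨A * A' + B * B', by positivity, fun t x => ?_⟩
    have hQj : ContDiffAt ℝ j Q x := (hQ.of_le (by exact_mod_cast le_top)).contDiffAt
    have hzj : ContDiffAt ℝ j (z t) x := ((hz t).1.of_le (by exact_mod_cast le_top)).contDiffAt
    -- The phase is constant in space and of modulus one, so it does not affect the norms of spatial
    -- derivatives.
    have e : u t = Complex.exp (Complex.I * (ω * t : ℝ)) • (Q + z t) := funext fun x => huz t x
    rw [e, iteratedFDeriv_const_smul_apply (f := Q + z t) (hQj.add hzj), iteratedFDeriv_add_apply hQj hzj,
      norm_smul, mul_comm Complex.I, Complex.norm_exp_ofReal_mul_I, one_mul, add_mul, mul_assoc,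
      mul_assoc]
    exact (norm_add_le _ _).trans (add_le_add
      ((hAb x).trans (mul_le_mul_of_nonneg_left (hAw x) hA.le))
      ((hBb t x).trans (mul_le_mul_of_nonneg_left (hBw x) hB.le)))
  obtain ⟨C₀, h₀, hC₀⟩ := bound 0 (by norm_num)
  obtain ⟨C₁, h₁, hC₁⟩ := bound 1 (by norm_num)
  obtain ⟨C₂, h₂, hC₂⟩ := bound 2 le_rfl
  refine ⟨C₀ + C₁ + C₂, hu, by positivity, fun t x => ?_, fun t j x => ?_, fun t j k x => ?_⟩
  all_goals have hw := weight_pos x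
  · refine le_trans ?_ ((hC₀ t x).trans ?_)
    · rw [norm_iteratedFDeriv_zero]
    · gcongr
      linarith
  · refine le_trans ?_ ((hC₁ t x).trans ?_)
    · rw [norm_iteratedFDeriv_one]
      simpa [pderiv] using (fderiv ℝ (u t) x).le_opNorm (EuclideanSpace.single j (1 : ℝ))
    · gcongr
      linarith
  · refine le_trans ?_ ((hC₂ t x).trans ?_)
    · rw [pderiv_pderiv (hu.1 t)]
      refine (ContinuousMultilinearMap.le_opNorm _ _).trans_eq ?_
      simp [Fin.prod_univ_two]
    · gcongr
      linarith

/-- A periodic differentiable function has a critical point. -/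
lemma exists_hasDerivAt_eq_zero_of_periodic {f f' : ℝ → ℝ} {T : ℝ} (hT : 0 < T)
    (hf : ∀ t, HasDerivAt f (f' t) t) (hper : f T = f 0) : ∃ t, f' t = 0 := by
  obtain ⟨t, -, ht⟩ := exists_hasDerivAt_eq_zero hT
    (fun t _ => (hf t).continuousAt.continuousWithinAt) hper.symm fun t _ => hf t
  exact ⟨t, ht⟩

/-- After factoring out `r²`, the coefficient `3a²/(64b)` is exactly the one that completes the
square in `r²`. Half of it is the energy threshold, because the virial relation controls `2E`. -/
lemma quartic_sextic_lower_bound {a b : ℝ} (hb : 0 < b) (r : ℝ) :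
    0 ≤ a / 2 * r ^ 4 + 4 * b / 3 * r ^ 6 + 3 * a ^ 2 / (64 * b) * r ^ 2 := by
  have e : a / 2 * r ^ 4 + 4 * b / 3 * r ^ 6 + 3 * a ^ 2 / (64 * b) * r ^ 2
      = 4 * b / 3 * (r * (r ^ 2 + 3 * a / (16 * b))) ^ 2 := by
    field_simp
    ring
  rw [e]
  positivity

/-- For a breather the virial derivative vanishes at some time. -/
lemma IsBreather.exists_virial_derivative_eq_zero {u : ℝ → E 3 → ℂ} {C : ℝ}
    (hB : IsBreather lam1 lam2 u) (hu : DecayingSolution lam1 lam2 u C) :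
    ∃ t, 2 * (∫ x, ∑ j, ‖pderiv (u t) j x‖ ^ 2)
      + 3 * (lam1 / 2 * (∫ x, ‖u t x‖ ^ 4) - 2 * lam2 / 3 * ∫ x, ‖u t x‖ ^ 6) = 0 := by
  obtain ⟨ω, Q, z, hω, -, -, -, -, hper, -, -⟩ := hB
  have hT : u (2 * Real.pi / ω) = u 0 := by
    funext x
    simpa using hper 0 x
  obtain ⟨t, ht⟩ := exists_hasDerivAt_eq_zero_of_periodic (T := 2 * Real.pi / ω) (by positivity)
    hu.hasDerivAt_virial (by rw [hT])
  refine ⟨t, ?_⟩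
  have i4 := ((hu.decaysC2 t).decays.norm_pow 3).integrable
  have i6 := ((hu.decaysC2 t).decays.norm_pow 5).integrable
  rw [integral_sub (i4.const_mul _) (i6.const_mul _), integral_const_mul,
    integral_const_mul] at ht
  exact_mod_cast ht

end CQNLS

end

theorem theorem4p2 (lam1 lam2 : ℝ) (hlam : 0 < lam1 * lam2)
    (u : ℝ → CQNLS.E 3 → ℂ) (hu : CQNLS.IsSolution lam1 lam2 u)
    (hP : ∀ j, CQNLS.momentum (u 0) j = 0)
    (hcase :
      (lam1 < 0 ∧
        3 * lam1 ^ 2 / (128 * |lam2|) * CQNLS.mass (u 0) < CQNLS.energy lam1 lam2 (u 0)) ∨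
      (0 < lam1 ∧ CQNLS.energy lam1 lam2 (u 0) < 0 ∧ 0 < CQNLS.virial (u 0))) :
    ¬ CQNLS.IsBreather lam1 lam2 u := by
  intro hB
  obtain ⟨C, hd⟩ := hB.exists_decayingSolution hu
  obtain ⟨t, ht⟩ := hB.exists_virial_derivative_eq_zero hd
  have hf := hd.decaysC2 t
  have i2 := hf.decays.norm_sq.integrable
  have i4 : Integrable fun x => ‖u t x‖ ^ 4 := (hf.decays.norm_pow 3).integrable
  have i6 : Integrable fun x => ‖u t x‖ ^ 6 := (hf.decays.norm_pow 5).integrable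
  have hE := hf.energy_eq lam1 lam2
  simp only [CQNLS.potential] at hE
  rw [integral_sub (i4.const_mul _) (i6.const_mul _), integral_const_mul, integral_const_mul,
    hd.energy_eq t 0] at hE
  rcases hcase with ⟨hneg, hlt⟩ | ⟨hpos, hlt, -⟩
  · have hlam2 : lam2 < 0 := by nlinarith
    rw [abs_of_neg hlam2, hd.mass_eq 0 t, CQNLS.mass] at hlt
    -- At the critical time `2E = -∫ ((λ₁/2)|u|⁴ + (4|λ₂|/3)|u|⁶)`, so this inequality gives `2E ≤
    -- (3λ₁²/(64|λ₂|)) M`.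
    have h : 0 ≤ ∫ x, (lam1 / 2 * ‖u t x‖ ^ 4 + 4 * -lam2 / 3 * ‖u t x‖ ^ 6
        + 3 * lam1 ^ 2 / (64 * -lam2) * ‖u t x‖ ^ 2) := integral_nonneg fun x =>
      CQNLS.quartic_sextic_lower_bound (neg_pos.2 hlam2) ‖u t x‖
    have i46 : Integrable fun x => lam1 / 2 * ‖u t x‖ ^ 4 + 4 * -lam2 / 3 * ‖u t x‖ ^ 6 :=
      (i4.const_mul _).add (i6.const_mul _)
    rw [integral_add i46 (i2.const_mul _),
      integral_add (i4.const_mul _) (i6.const_mul _), integral_const_mul, integral_const_mul,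
      integral_const_mul] at h
    have e : 3 * lam1 ^ 2 / (64 * -lam2) = 2 * (3 * lam1 ^ 2 / (128 * -lam2)) := by
      field_simp
      ring
    rw [e] at h
    linarith
  -- Eliminating the sextic term at the critical time leaves `E = (2/3)K + (λ₁/4)A ≥ 0`.
  · have hK : 0 ≤ ∫ x, ∑ j, ‖CQNLS.pderiv (u t) j x‖ ^ 2 :=
      integral_nonneg fun x => by positivity
    have hA : 0 ≤ lam1 * ∫ x, ‖u t x‖ ^ 4 :=
      mul_nonneg hpos.le (integral_nonneg fun x => by positivity)
    linarith
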